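/- Let $T\subset\mathbb{R}^2$ be a nondegenerate (closed) triangle with vertices $v_0,v_1,v_2$ and barycentric coordinates $\lambda=(\lambda_0,\lambda_1,\lambda_2)$. For $\alpha,\beta\in\mathbb{N}_0^3$ put $$R^\alpha_\beta=\frac{\lambda^\alpha}{(1-\lambda)^\beta}=\frac{\prod_{j=0}^2\lambda_j^{\alpha_j}}{\prod_{j=0}^2(1-\lambda_j)^{\beta_j}},\qquad |\alpha|=\alpha_0+\alpha_1+\alpha_2,\qquad \|\alpha+\beta\|_\infty=\max_{j}(\alpha_j+\beta_j).$$ Let $m\in\mathbb{N}_0$, and let $W^{m,p}(T)$ denote the Sobolev space of functions on the interior of $T$ whose weak derivatives of order at most $m$ exist and belong to $L^p$. Assume that $m=0$, or that $\beta_j\ge 1$ for at least one index $j$ with $\alpha_j+\beta_j=\|\alpha+\beta\|_\infty$ (in particular, this holds whenever all $\beta_j$ are positive). Then: - for $p\in[1,\infty)$: $R^\alpha_\beta\in W^{m,p}(T)$ if and only if $|\alpha|-\|\alpha+\beta\|_\infty>m-2/p$; - for $p=\infty$: $R^\alpha_\beta\in W^{m,\infty}(T)$ if and only if $|\alpha|-\|\alpha+\beta\|_\infty\ge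 m$. In particular: 1. for $p\in[1,2)$: $R^\alpha_\beta\in W^{m,p}(T)$ if and only if $m-1\le|\alpha|-\|\alpha+\beta\|_\infty$; 2. for $p\in[2,\infty]$: $R^\alpha_\beta\in W^{m,p}(T)$ if and only if $m\le|\alpha|-\|\alpha+\beta\|_\infty$. Moreover, for arbitrary $\alpha,\beta\in\mathbb{N}_0^3$ and $m\in\mathbb{N}_0$ (without the assumption above) each of these four conditions on $|\alpha|-\|\alpha+\beta\|_\infty$ is sufficient for the corresponding membership. -/

import Mathlib

open MeasureTheory Set
open scoped ENNReal

noncomputable section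

/-- The iterated classical partial derivative `∂_{I 0} ∂_{I 1} ⋯ ∂_{I (n-1)} φ` along the coordinate
directions listed by `I`. Every multi-index derivative of order `n` is of this form. -/
def partialDeriv {d n : ℕ} (I : Fin n → Fin d) (φ : EuclideanSpace ℝ (Fin d) → ℝ) :
    EuclideanSpace ℝ (Fin d) → ℝ :=
  fun x => iteratedFDeriv ℝ n φ x (fun k => EuclideanSpace.single (I k) (1 : ℝ))

/-- `g` is the weak partial derivative `∂_{I 0} ⋯ ∂_{I (n-1)} u` on the open set `Ω`: both functions
are locally integrable on `Ω`, and integration by parts holds against all smooth test functions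
with compact support in `Ω`. -/
def IsWeakPartialDeriv {d n : ℕ} (Ω : Set (EuclideanSpace ℝ (Fin d))) (I : Fin n → Fin d)
    (u g : EuclideanSpace ℝ (Fin d) → ℝ) : Prop :=
  LocallyIntegrableOn u Ω volume ∧ LocallyIntegrableOn g Ω volume ∧
    ∀ φ : EuclideanSpace ℝ (Fin d) → ℝ,
      ContDiff ℝ ((⊤ : ℕ∞) : WithTop ℕ∞) φ → HasCompactSupport φ → tsupport φ ⊆ Ω →
        ∫ x in Ω, u x * partialDeriv I φ x = (-1) ^ n * ∫ x in Ω, g x * φ x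

/-- `u ∈ W^{m,p}(Ω)` for an open set `Ω`: `u` is in `L^p(Ω)`, and all weak partial derivatives of
order at most `m` exist and are in `L^p(Ω)`. -/
def MemSobolev {d : ℕ} (Ω : Set (EuclideanSpace ℝ (Fin d))) (m : ℕ) (p : ℝ≥0∞)
    (u : EuclideanSpace ℝ (Fin d) → ℝ) : Prop :=
  MemLp u p (volume.restrict Ω) ∧
    ∀ n ≤ m, ∀ I : Fin n → Fin d, ∃ g : EuclideanSpace ℝ (Fin d) → ℝ,
      MemLp g p (volume.restrict Ω) ∧ IsWeakPartialDeriv Ω I u g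

/-- The (closed, nondegenerate) triangle with vertices `v 0`, `v 1`, `v 2`. Three points of the
plane form an affine basis exactly when they are not collinear. -/
def triangle (v : AffineBasis (Fin 3) ℝ (EuclideanSpace ℝ (Fin 2))) :
    Set (EuclideanSpace ℝ (Fin 2)) :=
  convexHull ℝ (range v)

/-- The rational function `λ^α / (1 - λ)^β` in the barycentric coordinates `λ j = v.coord j`
of the triangle. -/
def ratFun (v : AffineBasis (Fin 3) ℝ (EuclideanSpace ℝ (Fin 2))) (α β : Fin 3 → ℕ)
    (x : EuclideanSpace ℝ (Fin 2)) : ℝ :=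
  (∏ j, v.coord j x ^ α j) / ∏ j, (1 - v.coord j x) ^ β j

/-- The maximum norm `‖γ‖_∞` of a multi-index. -/
def multiIndexSup (γ : Fin 3 → ℕ) : ℕ := Finset.univ.sup γ

/-- The integer `|α| - ‖α + β‖_∞`, which may be negative. -/
def regularityIndex (α β : Fin 3 → ℕ) : ℤ :=
  ((∑ j, α j : ℕ) : ℤ) - (multiIndexSup (α + β) : ℤ)

end

/-- Smooth functions with compact support in `Ω`. -/
def IsTestFunction {E : Type*} [NormedAddCommGroup E] [NormedSpace ℝ E] (Ω : Set E) (φ : E → ℝ) :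
    Prop :=
  ContDiff ℝ ((⊤ : ℕ∞) : WithTop ℕ∞) φ ∧ HasCompactSupport φ ∧ tsupport φ ⊆ Ω

theorem integrable_mul_of_continuousOn_tsupport {E : Type*} [TopologicalSpace E]
    [MeasurableSpace E] [OpensMeasurableSpace E] {μ : Measure E} [IsFiniteMeasureOnCompacts μ] {Ω : Set E} (hΩ : IsOpen Ω) {f ψ : E → ℝ}
    (hf : ContinuousOn f Ω) (hψ : Continuous ψ) (hc : HasCompactSupport ψ)
    (hs : tsupport ψ ⊆ Ω) : Integrable (fun x => f x * ψ x) μ := by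
  have hsub : tsupport (fun x => f x * ψ x) ⊆ tsupport ψ := tsupport_mul_subset_right
  refine Continuous.integrable_of_hasCompactSupport ?_ hc.mul_left
  refine continuous_of_tsupport fun x hx => ?_
  exact (hf.continuousAt (hΩ.mem_nhds (hs (hsub hx)))).mul hψ.continuousAt

theorem setIntegral_mul_eq_integral_of_tsupport_subset {E : Type*} [TopologicalSpace E]
    [MeasurableSpace E] {μ : Measure E}
    {Ω : Set E} {f ψ : E → ℝ} (hs : tsupport ψ ⊆ Ω) :
    ∫ x in Ω, f x * ψ x ∂μ = ∫ x, f x * ψ x ∂μ := by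
  refine setIntegral_eq_integral_of_forall_compl_eq_zero fun x hx => ?_
  rw [image_eq_zero_of_notMem_tsupport fun h => hx (hs h), mul_zero]

section WeakDerivatives

variable {E : Type*} [NormedAddCommGroup E] [NormedSpace ℝ E]

/-- Integration by parts on an open set against a test function. -/
theorem setIntegral_mul_fderiv_eq_neg [FiniteDimensional ℝ E] [MeasurableSpace E] [BorelSpace E]
    {μ : Measure E} [μ.IsAddHaarMeasure] {Ω : Set E} (hΩ : IsOpen Ω) {u φ : E → ℝ}
    (hu : ContDiffOn ℝ 1 u Ω) (hφ : IsTestFunction Ω φ) (a : E) :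
    ∫ x in Ω, u x * fderiv ℝ φ x a ∂μ = -∫ x in Ω, fderiv ℝ u x a * φ x ∂μ := by
  obtain ⟨hφ, hc, hs⟩ := hφ
  have hs' : tsupport (fun x => fderiv ℝ φ x a) ⊆ Ω := (tsupport_fderiv_apply_subset ℝ a).trans hs
  rw [setIntegral_mul_eq_integral_of_tsupport_subset hs,
    setIntegral_mul_eq_integral_of_tsupport_subset hs']
  refine integral_mul_fderiv_eq_neg_fderiv_mul_of_integrable ?_ ?_ ?_ ?_ ?_
  · refine integrable_mul_of_continuousOn_tsupport hΩ ?_ hφ.continuous hc hs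
    exact (hu.continuousOn_fderiv_of_isOpen hΩ le_rfl).clm_apply continuousOn_const
  · refine integrable_mul_of_continuousOn_tsupport hΩ hu.continuousOn ?_ (hc.fderiv_apply ℝ a) hs'
    exact (hφ.continuous_fderiv (by simp)).clm_apply continuous_const
  · exact integrable_mul_of_continuousOn_tsupport hΩ hu.continuousOn hφ.continuous hc hs
  · exact fun x hx => (hu.contDiffAt (hΩ.mem_nhds (hs hx))).differentiableAt (by simp)
  · exact fun x _ => hφ.differentiable (by simp) x

theorem iteratedFDeriv_succ_apply_eq_fderiv {n : ℕ} {φ : E → ℝ}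
    (hφ : ContDiff ℝ ((⊤ : ℕ∞) : WithTop ℕ∞) φ) (a : Fin (n + 1) → E) (x : E) :
    iteratedFDeriv ℝ (n + 1) φ x a =
      fderiv ℝ (fun y => iteratedFDeriv ℝ n φ y (Fin.tail a)) x (a 0) := by
  rw [iteratedFDeriv_succ_apply_left]
  have hd : DifferentiableAt ℝ (iteratedFDeriv ℝ n φ) x :=
    hφ.differentiable_iteratedFDeriv (by exact_mod_cast ENat.natCast_lt_top n) x
  rw [fderiv_continuousMultilinear_apply_const_apply hd]

theorem IsTestFunction.iteratedFDeriv_apply {Ω : Set E} {φ : E → ℝ} (hφ : IsTestFunction Ω φ)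
    {n : ℕ} (a : Fin n → E) : IsTestFunction Ω fun x => iteratedFDeriv ℝ n φ x a := by
  obtain ⟨hφ, hc, hs⟩ := hφ
  have hsub : tsupport (fun x => iteratedFDeriv ℝ n φ x a) ⊆ tsupport φ := by
    refine (closure_mono fun x hx => ?_).trans (tsupport_iteratedFDeriv_subset (𝕜 := ℝ) n)
    rw [Function.mem_support] at hx ⊢
    rintro h
    simp [h] at hx
  refine ⟨?_, hc.mono' (subset_closure.trans hsub), hsub.trans hs⟩
  exact (ContinuousMultilinearMap.apply ℝ (fun _ : Fin n => E) ℝ a).contDiff.comp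
    (hφ.iteratedFDeriv_right (by exact le_of_eq rfl))

/-- One directional derivative moved from the test function to a smooth function. -/
theorem setIntegral_mul_iteratedFDeriv_succ [FiniteDimensional ℝ E] [MeasurableSpace E]
    [BorelSpace E] {μ : Measure E} [μ.IsAddHaarMeasure] {Ω : Set E} (hΩ : IsOpen Ω)
    {u u' g φ : E → ℝ} {n : ℕ} {a : Fin (n + 1) → E} (hu : ContDiffOn ℝ 1 u Ω)
    (hu' : ∀ x ∈ Ω, fderiv ℝ u x (a 0) = u' x) (hφ : IsTestFunction Ω φ)
    (h : ∫ x in Ω, u' x * iteratedFDeriv ℝ n φ x (Fin.tail a) ∂μ =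
      (-1) ^ n * ∫ x in Ω, g x * φ x ∂μ) :
    ∫ x in Ω, u x * iteratedFDeriv ℝ (n + 1) φ x a ∂μ =
      (-1) ^ (n + 1) * ∫ x in Ω, g x * φ x ∂μ := by
  simp_rw [iteratedFDeriv_succ_apply_eq_fderiv hφ.1]
  rw [setIntegral_mul_fderiv_eq_neg hΩ hu (hφ.iteratedFDeriv_apply (Fin.tail a)),
    setIntegral_congr_fun (g := fun x => u' x * iteratedFDeriv ℝ n φ x (Fin.tail a))
      hΩ.measurableSet (fun x hx => by simp only [hu' x hx]), h]
  ring

/-- The derivative in direction `a`. -/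
noncomputable def dirDeriv (a : E) (f : E → ℝ) (x : E) : ℝ := fderiv ℝ f x a

theorem ContDiffOn.dirDeriv {Ω : Set E} (hΩ : IsOpen Ω) {f : E → ℝ}
    (hf : ContDiffOn ℝ ((⊤ : ℕ∞) : WithTop ℕ∞) f Ω) (a : E) :
    ContDiffOn ℝ ((⊤ : ℕ∞) : WithTop ℕ∞) (dirDeriv a f) Ω :=
  (hf.fderiv_of_isOpen hΩ (m := ((⊤ : ℕ∞) : WithTop ℕ∞)) (by exact le_of_eq rfl)).clm_apply
    contDiffOn_const

theorem ContDiffOn.iterate_dirDeriv {Ω : Set E} (hΩ : IsOpen Ω) {f : E → ℝ}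
    (hf : ContDiffOn ℝ ((⊤ : ℕ∞) : WithTop ℕ∞) f Ω) (a : E) (n : ℕ) :
    ContDiffOn ℝ ((⊤ : ℕ∞) : WithTop ℕ∞) ((_root_.dirDeriv a)^[n] f) Ω := by
  induction n with
  | zero => exact hf
  | succ n ih => rw [Function.iterate_succ_apply']; exact ih.dirDeriv hΩ a

theorem setIntegral_mul_iteratedFDeriv_const [FiniteDimensional ℝ E] [MeasurableSpace E]
    [BorelSpace E] {μ : Measure E} [μ.IsAddHaarMeasure] {Ω : Set E} (hΩ : IsOpen Ω) (a : E) (n : ℕ)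
    {u φ : E → ℝ} (hu : ContDiffOn ℝ ((⊤ : ℕ∞) : WithTop ℕ∞) u Ω) (hφ : IsTestFunction Ω φ) :
    ∫ x in Ω, u x * iteratedFDeriv ℝ n φ x (fun _ => a) ∂μ =
      (-1) ^ n * ∫ x in Ω, (dirDeriv a)^[n] u x * φ x ∂μ := by
  induction n generalizing u with
  | zero => simp
  | succ n ih =>
    rw [Function.iterate_succ_apply]
    exact setIntegral_mul_iteratedFDeriv_succ hΩ (hu.of_le (by exact_mod_cast le_top))
      (fun x _ => rfl) hφ (ih (hu.dirDeriv hΩ a))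

end WeakDerivatives

theorem partialDeriv_sum_eq_iteratedFDeriv {d n : ℕ} (φ : EuclideanSpace ℝ (Fin d) → ℝ)
    (a x : EuclideanSpace ℝ (Fin d)) :
    iteratedFDeriv ℝ n φ x (fun _ => a) =
      ∑ I : Fin n → Fin d, (∏ k, a (I k)) * partialDeriv I φ x := by
  have ha : a = ∑ i, a i • EuclideanSpace.single i (1 : ℝ) := by
    ext j; simp [Pi.single_apply]
  conv_lhs => rw [ha]
  rw [ContinuousMultilinearMap.map_sum]
  refine Finset.sum_congr rfl fun I _ => ?_
  rw [ContinuousMultilinearMap.map_smul_univ]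
  rfl

/-- If the weak partial derivatives of order `n` of a smooth function are in `L^p`, then so are its
classical directional derivatives of order `n`. -/
theorem MemSobolev.memLp_iterate_dirDeriv {d m : ℕ} {Ω : Set (EuclideanSpace ℝ (Fin d))}
    (hΩ : IsOpen Ω) {p : ℝ≥0∞} {u : EuclideanSpace ℝ (Fin d) → ℝ} (h : MemSobolev Ω m p u)
    (hu : ContDiffOn ℝ ((⊤ : ℕ∞) : WithTop ℕ∞) u Ω) (a : EuclideanSpace ℝ (Fin d)) :
    MemLp ((dirDeriv a)^[m] u) p (volume.restrict Ω) := by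
  choose g hgp hloc hg hint using h.2 m le_rfl
  set G : EuclideanSpace ℝ (Fin d) → ℝ := fun x => ∑ I : Fin m → Fin d, (∏ k, a (I k)) * g I x
    with hG
  have hGp : MemLp G p (volume.restrict Ω) :=
    memLp_finsetSum _ fun I _ => (hgp I).const_mul _
  have hsmooth := hu.iterate_dirDeriv hΩ a m
  have hcl : LocallyIntegrableOn ((dirDeriv a)^[m] u) Ω volume :=
    hsmooth.continuousOn.locallyIntegrableOn hΩ.measurableSet
  have hmul : ∀ (f φ : EuclideanSpace ℝ (Fin d) → ℝ), LocallyIntegrableOn f Ω volume →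
      IsTestFunction Ω φ → IntegrableOn (fun x => f x * φ x) Ω volume := by
    intro f φ hf hφ
    have hK := (hf.integrableOn_compact_subset hφ.2.2 hφ.2.1).mul_continuousOn
      hφ.1.continuous.continuousOn hφ.2.1
    have : IntegrableOn (fun x => f x * φ x) univ volume :=
      hK.of_forall_sdiff_eq_zero MeasurableSet.univ fun x hx => by
        simp [image_eq_zero_of_notMem_tsupport hx.2]
    exact this.mono_set (subset_univ _)
  have hGloc : LocallyIntegrableOn G Ω volume := by
    rw [locallyIntegrableOn_iff hΩ.isLocallyClosed]
    intro K hK hKc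
    refine integrable_finsetSum _ fun I _ => ?_
    exact ((hg I).integrableOn_compact_subset hK hKc).const_mul _
  have hsub : LocallyIntegrableOn (fun x => (dirDeriv a)^[m] u x - G x) Ω volume := hcl.sub hGloc
  have hae : ∀ᵐ x ∂volume, x ∈ Ω → (dirDeriv a)^[m] u x - G x = 0 := by
    refine hΩ.ae_eq_zero_of_integral_contDiff_smul_eq_zero hsub fun φ h1 h2 h3 => ?_
    have hφ : IsTestFunction Ω φ := ⟨h1, h2, h3⟩
    have e1 := setIntegral_mul_iteratedFDeriv_const (μ := volume) hΩ a m hu hφ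
    have e2 : ∫ x in Ω, u x * iteratedFDeriv ℝ m φ x (fun _ => a) =
        (-1) ^ m * ∫ x in Ω, G x * φ x := by
      simp_rw [partialDeriv_sum_eq_iteratedFDeriv, hG, Finset.mul_sum, Finset.sum_mul]
      rw [integral_finsetSum, integral_finsetSum, Finset.mul_sum]
      · refine Finset.sum_congr rfl fun I _ => ?_
        have := hint I φ h1 h2 h3
        simp_rw [mul_left_comm (u _), mul_assoc, integral_const_mul, this]
        ring
      · intro I _
        simp_rw [mul_assoc]
        exact (hmul _ _ (hg I) hφ).const_mul _
      · intro I _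
        simp_rw [mul_left_comm (u _)]
        exact (hmul _ _ (hloc I) (hφ.iteratedFDeriv_apply _)).const_mul _
    rw [e1] at e2
    have e3 := mul_left_cancel₀ (pow_ne_zero m (by norm_num : (-1 : ℝ) ≠ 0)) e2
    have : ∀ x, φ x • ((dirDeriv a)^[m] u x - G x) =
        ((dirDeriv a)^[m] u x - G x) * φ x := fun x => by rw [smul_eq_mul, mul_comm]
    simp_rw [this]
    rw [← setIntegral_mul_eq_integral_of_tsupport_subset h3]
    simp_rw [sub_mul]
    rw [integral_sub (hmul _ _ hcl hφ) (hmul _ _ hGloc hφ), e3, sub_self]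
  refine hGp.ae_eq ?_
  rw [Filter.EventuallyEq, ae_restrict_iff' hΩ.measurableSet]
  filter_upwards [hae] with x hx hxΩ
  linarith [hx hxΩ]

theorem le_regularityIndex_iff {α β : Fin 3 → ℕ} {k : ℤ} :
    k ≤ regularityIndex α β ↔ ∀ j, k + (α j + β j : ℕ) ≤ (∑ i, α i : ℕ) := by
  have h : ∀ j, (α + β) j ≤ multiIndexSup (α + β) := fun j => Finset.le_sup (Finset.mem_univ j)
  obtain ⟨i, -, hi⟩ := Finset.exists_mem_eq_sup Finset.univ Finset.univ_nonempty (α + β)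
  have hi : multiIndexSup (α + β) = (α + β) i := hi
  simp only [Pi.add_apply] at h hi
  unfold regularityIndex
  constructor
  · intro hk j
    have := h j
    lia
  · intro hk
    have := hk i
    lia

section Barycentric

variable (v : AffineBasis (Fin 3) ℝ (EuclideanSpace ℝ (Fin 2)))

theorem mem_interior_triangle {x : EuclideanSpace ℝ (Fin 2)} :
    x ∈ interior (triangle v) ↔ ∀ j, 0 < v.coord j x := by
  rw [triangle, v.interior_convexHull, mem_ofPred_eq]

theorem isBounded_interior_triangle : Bornology.IsBounded (interior (triangle v)) :=
  ((finite_range v).isCompact_convexHull ℝ).isBounded.subset interior_subset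

theorem coord_add_eq_one (x : EuclideanSpace ℝ (Fin 2)) :
    v.coord 0 x + v.coord 1 x + v.coord 2 x = 1 := by
  rw [← v.sum_coord_apply_eq_one x, Fin.sum_univ_three]

theorem coord_add_le_one {x : EuclideanSpace ℝ (Fin 2)} (hx : x ∈ interior (triangle v))
    {i j : Fin 3} (hij : i ≠ j) : v.coord i x + v.coord j x ≤ 1 := by
  rw [mem_interior_triangle] at hx
  have h := coord_add_eq_one v x
  have h0 := hx 0
  have h1 := hx 1
  have h2 := hx 2
  fin_cases i <;> fin_cases j <;> simp at hij ⊢ <;> linarith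

theorem coord_lt_one {x : EuclideanSpace ℝ (Fin 2)} (hx : x ∈ interior (triangle v)) (j : Fin 3) :
    v.coord j x < 1 := by
  obtain ⟨i, hi⟩ := exists_ne j
  have := coord_add_le_one v hx hi
  have := (mem_interior_triangle v).1 hx i
  linarith

/-- The linear part of the barycentric coordinate `v.coord j`. -/
noncomputable def coordLinear (j : Fin 3) : EuclideanSpace ℝ (Fin 2) →L[ℝ] ℝ :=
  LinearMap.toContinuousLinearMap (v.coord j).linear

theorem coord_add (j : Fin 3) (x w : EuclideanSpace ℝ (Fin 2)) :
    v.coord j (x + w) = v.coord j x + coordLinear v j w := by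
  rw [add_comm x, ← vadd_eq_add, AffineMap.map_vadd, vadd_eq_add, add_comm]
  rfl

theorem coordLinear_sub (j : Fin 3) (x y : EuclideanSpace ℝ (Fin 2)) :
    coordLinear v j (x - y) = v.coord j x - v.coord j y := by
  have := coord_add v j y (x - y)
  rw [add_sub_cancel] at this
  linarith

theorem coord_eq_zero_add (j : Fin 3) :
    (v.coord j : EuclideanSpace ℝ (Fin 2) → ℝ) = fun x => v.coord j 0 + coordLinear v j x := by
  ext x
  rw [← coord_add, zero_add]

theorem hasFDerivAt_coord (j : Fin 3) (x : EuclideanSpace ℝ (Fin 2)) :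
    HasFDerivAt (v.coord j) (coordLinear v j) x := by
  rw [coord_eq_zero_add]
  exact (coordLinear v j).hasFDerivAt.const_add _

theorem contDiff_coord (j : Fin 3) {n : WithTop ℕ∞} : ContDiff ℝ n (v.coord j) := by
  rw [coord_eq_zero_add]
  exact contDiff_const.add (coordLinear v j).contDiff

theorem ratFun_eq_prod (α β : Fin 3 → ℕ) (x : EuclideanSpace ℝ (Fin 2)) :
    ratFun v α β x = ∏ j, v.coord j x ^ α j / (1 - v.coord j x) ^ β j :=
  (Finset.prod_div_distrib ..).symm

theorem contDiffOn_ratFun (α β : Fin 3 → ℕ) {n : WithTop ℕ∞} :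
    ContDiffOn ℝ n (ratFun v α β) (interior (triangle v)) := by
  refine ContDiffOn.div (contDiff_prod fun j _ => (contDiff_coord v j).pow _).contDiffOn
    (contDiff_prod fun j _ => (contDiff_const.sub (contDiff_coord v j)).pow _).contDiffOn ?_
  intro x hx
  exact Finset.prod_ne_zero_iff.2 fun j _ => pow_ne_zero _ (sub_ne_zero.2 (coord_lt_one v hx j).ne')

theorem hasDerivAt_pow_div_one_sub_pow (a b : ℕ) {s : ℝ} (hs : s ≠ 1) :
    HasDerivAt (fun s : ℝ => s ^ a / (1 - s) ^ b)
      (a * (s ^ (a - 1) / (1 - s) ^ b) + b * (s ^ a / (1 - s) ^ (b + 1))) s := by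
  have h1 : (1 - s) ≠ 0 := sub_ne_zero.2 hs.symm
  have h := (hasDerivAt_pow a s).div (((hasDerivAt_id s).const_sub 1).pow b)
    (pow_ne_zero b h1)
  convert! h using 1
  rcases b with _ | b
  · simp
  · simp only [id, Pi.pow_apply, Nat.add_sub_cancel]
    field_simp
    push_cast
    ring

theorem ratFun_update_left (α β : Fin 3 → ℕ) (j : Fin 3) (n : ℕ) (x : EuclideanSpace ℝ (Fin 2)) :
    ratFun v (Function.update α j n) β x =
      (∏ i ∈ Finset.univ.erase j, v.coord i x ^ α i / (1 - v.coord i x) ^ β i) *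
        (v.coord j x ^ n / (1 - v.coord j x) ^ β j) := by
  rw [ratFun_eq_prod, ← Finset.prod_erase_mul _ _ (Finset.mem_univ j), Function.update_self]
  congr 1
  refine Finset.prod_congr rfl fun i hi => ?_
  rw [Function.update_of_ne (Finset.ne_of_mem_erase hi)]

theorem ratFun_update_right (α β : Fin 3 → ℕ) (j : Fin 3) (n : ℕ) (x : EuclideanSpace ℝ (Fin 2)) :
    ratFun v α (Function.update β j n) x =
      (∏ i ∈ Finset.univ.erase j, v.coord i x ^ α i / (1 - v.coord i x) ^ β i) *
        (v.coord j x ^ α j / (1 - v.coord j x) ^ n) := by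
  rw [ratFun_eq_prod, ← Finset.prod_erase_mul _ _ (Finset.mem_univ j), Function.update_self]
  congr 1
  refine Finset.prod_congr rfl fun i hi => ?_
  rw [Function.update_of_ne (Finset.ne_of_mem_erase hi)]

/-- The derivative of `λ^α / (1 - λ)^β` is a combination of functions of the same form. -/
theorem fderiv_ratFun_apply (α β : Fin 3 → ℕ) {x : EuclideanSpace ℝ (Fin 2)}
    (hx : x ∈ interior (triangle v)) (a : EuclideanSpace ℝ (Fin 2)) :
    fderiv ℝ (ratFun v α β) x a =
      ∑ j, ((coordLinear v j a * α j) * ratFun v (Function.update α j (α j - 1)) β x +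
        (coordLinear v j a * β j) * ratFun v α (Function.update β j (β j + 1)) x) := by
  have h := HasFDerivAt.finsetProd (u := Finset.univ) fun j _ =>
    (hasDerivAt_pow_div_one_sub_pow (α j) (β j) (coord_lt_one v hx j).ne).comp_hasFDerivAt x
      (hasFDerivAt_coord v j x)
  have h' : HasFDerivAt (ratFun v α β) _ x :=
    h.congr_of_eventuallyEq (.of_forall fun y => by simp [ratFun_eq_prod])
  rw [h'.fderiv, _root_.sum_apply]
  refine Finset.sum_congr rfl fun j _ => ?_
  simp only [ratFun_update_left, ratFun_update_right, _root_.smul_apply, smul_eq_mul,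
    Function.comp_apply]
  ring

/-- The span of the functions `λ^α / (1 - λ)^β` of regularity index at least `k`. -/
noncomputable def ratSpan (k : ℤ) : Submodule ℝ (EuclideanSpace ℝ (Fin 2) → ℝ) :=
  Submodule.span ℝ {f | ∃ α β, k ≤ regularityIndex α β ∧ f = ratFun v α β}

variable {v}

theorem contDiffOn_of_mem_ratSpan {k : ℤ} {f : EuclideanSpace ℝ (Fin 2) → ℝ} (hf : f ∈ ratSpan v k)
    {n : WithTop ℕ∞} : ContDiffOn ℝ n f (interior (triangle v)) := by
  induction hf using Submodule.span_induction with
  | mem f h => obtain ⟨α, β, -, rfl⟩ := h; exact contDiffOn_ratFun v α β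
  | zero => exact contDiffOn_const
  | add f g _ _ hf hg => exact hf.add hg
  | smul c f _ hf => exact contDiffOn_const.smul hf

theorem exists_mem_ratSpan_fderiv_apply_eq {k : ℤ} {f : EuclideanSpace ℝ (Fin 2) → ℝ}
    (hf : f ∈ ratSpan v k) (a : EuclideanSpace ℝ (Fin 2)) :
    ∃ g ∈ ratSpan v (k - 1), ∀ x ∈ interior (triangle v), fderiv ℝ f x a = g x := by
  have hdiff : ∀ f ∈ ratSpan v k, ∀ x ∈ interior (triangle v), DifferentiableAt ℝ f x :=
    fun f hf x hx => ((contDiffOn_of_mem_ratSpan hf (n := 1)).contDiffAt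
      (isOpen_interior.mem_nhds hx)).differentiableAt (by simp)
  induction hf using Submodule.span_induction with
  | mem f h =>
    obtain ⟨α, β, hk, rfl⟩ := h
    refine ⟨∑ j, ((coordLinear v j a * α j) • ratFun v (Function.update α j (α j - 1)) β +
        (coordLinear v j a * β j) • ratFun v α (Function.update β j (β j + 1))), ?_, ?_⟩
    · rw [le_regularityIndex_iff] at hk
      simp only [Fin.forall_fin_succ, Fin.sum_univ_three] at hk
      refine Submodule.sum_mem _ fun j _ => Submodule.add_mem _
        (Submodule.smul_mem _ _ (Submodule.subset_span ⟨_, _, ?_, rfl⟩))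
        (Submodule.smul_mem _ _ (Submodule.subset_span ⟨_, _, ?_, rfl⟩)) <;>
      · rw [le_regularityIndex_iff]
        simp only [Fin.forall_fin_succ, Fin.sum_univ_three]
        fin_cases j <;> simp at hk ⊢ <;> lia
    · intro x hx
      rw [fderiv_ratFun_apply v α β hx]
      simp
  | zero => exact ⟨0, Submodule.zero_mem _, fun x _ => by simp⟩
  | add f g hf hg ihf ihg =>
    obtain ⟨f', hf', h1⟩ := ihf
    obtain ⟨g', hg', h2⟩ := ihg
    refine ⟨f' + g', Submodule.add_mem _ hf' hg', fun x hx => ?_⟩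
    rw [fderiv_add (hdiff f hf x hx) (hdiff g hg x hx)]
    simp [h1 x hx, h2 x hx]
  | smul c f hf ih =>
    obtain ⟨f', hf', h1⟩ := ih
    refine ⟨c • f', Submodule.smul_mem _ _ hf', fun x hx => ?_⟩
    rw [fderiv_const_smul (hdiff f hf x hx)]
    simp [h1 x hx]

theorem exists_mem_ratSpan_weakDeriv {n : ℕ} (a : Fin n → EuclideanSpace ℝ (Fin 2)) {k : ℤ}
    {f : EuclideanSpace ℝ (Fin 2) → ℝ} (hf : f ∈ ratSpan v k) :
    ∃ g ∈ ratSpan v (k - n), ∀ φ, IsTestFunction (interior (triangle v)) φ →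
      ∫ x in interior (triangle v), f x * iteratedFDeriv ℝ n φ x a =
        (-1) ^ n * ∫ x in interior (triangle v), g x * φ x := by
  induction n generalizing f k with
  | zero => exact ⟨f, by simpa using hf, by simp⟩
  | succ n ih =>
    obtain ⟨f', hf', h⟩ := exists_mem_ratSpan_fderiv_apply_eq hf (a 0)
    obtain ⟨g, hg, hint⟩ := ih (Fin.tail a) hf'
    refine ⟨g, by convert hg using 2; push_cast; ring, fun φ hφ => ?_⟩
    exact setIntegral_mul_iteratedFDeriv_succ isOpen_interior (contDiffOn_of_mem_ratSpan hf) h hφ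
      (hint φ hφ)

end Barycentric

theorem memLp_inv_norm_ball {p : ℝ≥0∞} (hp : 1 ≤ p) (hp2 : p < 2) (r : ℝ) :
    MemLp (fun x : EuclideanSpace ℝ (Fin 2) => ‖x‖⁻¹) p (volume.restrict (Metric.ball 0 r)) := by
  have hp0 : p ≠ 0 := (zero_lt_one.trans_le hp).ne'
  have hptop : p ≠ ⊤ := (hp2.trans_le le_top).ne
  have hmeas : Measurable fun x : EuclideanSpace ℝ (Fin 2) => ‖x‖⁻¹ := by fun_prop
  have hlt : p.toReal < 2 := by
    have := (ENNReal.toReal_lt_toReal hptop (by simp)).2 hp2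
    simpa using this
  rw [← integrable_norm_rpow_iff hmeas.aestronglyMeasurable hp0 hptop]
  refine integrableOn_ball_of_norm_le_rpow (C := 1) (α := p.toReal) (by simp) (by simpa using hlt)
    (.of_forall fun x => ?_) (hmeas.norm.pow_const _).aestronglyMeasurable
  rw [norm_inv, norm_norm, Real.rpow_neg (norm_nonneg x), Real.inv_rpow (norm_nonneg x), one_mul,
    Real.norm_of_nonneg (by positivity)]

section Bounds

variable (v : AffineBasis (Fin 3) ℝ (EuclideanSpace ℝ (Fin 2)))

theorem norm_sub_vertex_le {x : EuclideanSpace ℝ (Fin 2)} (hx : x ∈ interior (triangle v))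
    (j : Fin 3) : ‖x - v j‖ ≤ (∑ i, ‖v i - v j‖) * (1 - v.coord j x) := by
  have h : x - v j = ∑ i, v.coord i x • (v i - v j) := by
    simp_rw [smul_sub, Finset.sum_sub_distrib, ← Finset.sum_smul, v.sum_coord_apply_eq_one,
      v.linear_combination_coord_eq_self, one_smul]
  rw [h, Finset.sum_mul]
  refine norm_sum_le_of_le _ fun i _ => ?_
  rcases eq_or_ne i j with rfl | hij
  · simp
  · rw [norm_smul, mul_comm, Real.norm_of_nonneg ((mem_interior_triangle v).1 hx i).le]
    have := coord_add_le_one v hx hij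
    gcongr
    linarith

theorem memLp_inv_one_sub_coord {p : ℝ≥0∞} (hp : 1 ≤ p) (hp2 : p < 2) (j : Fin 3) :
    MemLp (fun x => (1 - v.coord j x)⁻¹) p (volume.restrict (interior (triangle v))) := by
  obtain ⟨r, hr⟩ := (isBounded_interior_triangle v).subset_ball (v j)
  have h1 : MemLp (fun x => ‖x - v j‖⁻¹) p (volume.restrict (Metric.ball (v j) r)) := by
    have hpres := (measurePreserving_sub_right (volume : Measure (EuclideanSpace ℝ (Fin 2)))
      (v j)).restrict_preimage (s := Metric.ball 0 r) measurableSet_ball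
    have hball : (fun x => x - v j) ⁻¹' Metric.ball 0 r = Metric.ball (v j) r := by
      ext x; simp [dist_eq_norm]
    rw [hball] at hpres
    exact (memLp_inv_norm_ball hp hp2 r).comp_measurePreserving hpres
  have h2 := (h1.mono_measure (Measure.restrict_mono hr le_rfl)).const_mul (∑ i, ‖v i - v j‖)
  refine h2.mono ?_ ?_
  · have := (contDiff_coord v j (n := 0)).continuous.measurable
    fun_prop
  · refine ae_restrict_of_forall_mem isOpen_interior.measurableSet fun x hx => ?_
    have hs := sub_pos.2 (coord_lt_one v hx j)
    have hn := norm_sub_vertex_le v hx j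
    have hpos : 0 < ‖x - v j‖ := by
      rw [norm_pos_iff, sub_ne_zero]
      rintro rfl
      simpa using coord_lt_one v hx j
    have hM : 0 ≤ (∑ i, ‖v i - v j‖) * ‖x - v j‖⁻¹ :=
      mul_nonneg (Finset.sum_nonneg fun i _ => norm_nonneg _) (inv_nonneg.2 hpos.le)
    rw [Real.norm_of_nonneg (inv_nonneg.2 hs.le), Real.norm_of_nonneg hM, ← div_eq_mul_inv,
      inv_eq_one_div, div_le_div_iff₀ hs hpos]
    linarith

theorem abs_ratFun_le {α β : Fin 3 → ℕ} {k : ℤ} (hk : k ≤ regularityIndex α β)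
    {x : EuclideanSpace ℝ (Fin 2)} (hx : x ∈ interior (triangle v)) :
    |ratFun v α β x| ≤ 2 ^ (∑ j, β j) * ∑ j, (1 - v.coord j x) ^ k := by
  have hpos := (mem_interior_triangle v).1 hx
  have hlt := fun j => sub_pos.2 (coord_lt_one v hx j)
  obtain ⟨j, hj⟩ : ∃ j, ∀ i, i ≠ j → v.coord i x ≤ 1 / 2 := by
    by_contra! h
    obtain ⟨i, hi, h1⟩ := h 0
    obtain ⟨i', hi', h2⟩ := h i
    have := coord_add_le_one v hx hi'
    linarith
  set s := 1 - v.coord j x with hs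
  have hs0 : 0 < s := hlt j
  have hs1 : s ≤ 1 := by linarith [hpos j]
  have hfac : ∀ i, v.coord i x ^ α i / (1 - v.coord i x) ^ β i ≤
      2 ^ β i * s ^ (if i = j then -(β j : ℤ) else (α i : ℤ)) := by
    intro i
    have h0 := (hpos i).le
    split_ifs with hij
    · subst hij
      rw [zpow_neg, zpow_natCast, div_eq_mul_inv]
      have h1 : v.coord i x ^ α i ≤ 1 := pow_le_one₀ h0 (by linarith [hlt i])
      have h2 : (1 : ℝ) ≤ 2 ^ β i := one_le_pow₀ (by norm_num)
      gcongr
      exact h1.trans h2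
    · rw [zpow_natCast, div_le_iff₀ (pow_pos (hlt i) _)]
      have h1 : v.coord i x ≤ s := by linarith [coord_add_le_one v hx hij]
      have h2 : 1 ≤ 2 ^ β i * (1 - v.coord i x) ^ β i := by
        rw [← mul_pow]
        exact one_le_pow₀ (by linarith [hj i hij])
      calc v.coord i x ^ α i ≤ s ^ α i := by gcongr
        _ = 1 * s ^ α i := (one_mul _).symm
        _ ≤ (2 ^ β i * (1 - v.coord i x) ^ β i) * s ^ α i := by gcongr
        _ = _ := by ring
  rw [ratFun_eq_prod, abs_of_nonneg (Finset.prod_nonneg fun i _ =>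
    div_nonneg (pow_nonneg (hpos i).le _) (pow_nonneg (hlt i).le _))]
  calc ∏ i, v.coord i x ^ α i / (1 - v.coord i x) ^ β i
      ≤ ∏ i, 2 ^ β i * s ^ (if i = j then -(β j : ℤ) else (α i : ℤ)) :=
        Finset.prod_le_prod (fun i _ =>
          div_nonneg (pow_nonneg (hpos i).le _) (pow_nonneg (hlt i).le _)) fun i _ => hfac i
    _ = 2 ^ (∑ i, β i) * s ^ ((∑ i, (α i : ℤ)) - (α j + β j)) := by
        rw [Finset.prod_mul_distrib, Finset.prod_pow_eq_pow_sum]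
        congr 1
        fin_cases j <;> simp [Fin.prod_univ_three, Fin.sum_univ_three, ← zpow_add₀ hs0.ne',
          -zpow_natCast, -zpow_neg] <;> ring_nf
    _ ≤ 2 ^ (∑ i, β i) * s ^ k := by
        have := le_regularityIndex_iff.1 hk j
        gcongr 2 ^ _ * ?_
        refine zpow_le_zpow_right_of_le_one₀ hs0 hs1 ?_
        push_cast at this
        linarith
    _ ≤ 2 ^ (∑ i, β i) * ∑ i, (1 - v.coord i x) ^ k := by
        gcongr
        exact Finset.single_le_sum (f := fun i => (1 - v.coord i x) ^ k)
          (fun i _ => (zpow_pos (hlt i) _).le) (Finset.mem_univ j)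

variable {v}

theorem memLp_ratFun {α β : Fin 3 → ℕ} {p : ℝ≥0∞} (hp : 1 ≤ p)
    (h : 0 ≤ regularityIndex α β ∨ p < 2 ∧ -1 ≤ regularityIndex α β) :
    MemLp (ratFun v α β) p (volume.restrict (interior (triangle v))) := by
  obtain ⟨k, hk, hLp⟩ : ∃ k ≤ regularityIndex α β, MemLp (fun x => ∑ j, (1 - v.coord j x) ^ k) p
      (volume.restrict (interior (triangle v))) := by
    rcases h with h | ⟨hp2, h⟩
    · have : IsFiniteMeasure (volume.restrict (interior (triangle v))) :=
        ⟨by simpa using (isBounded_interior_triangle v).measure_lt_top⟩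
      exact ⟨0, h, by simpa using memLp_const _⟩
    · refine ⟨-1, h, memLp_finsetSum _ fun j _ => ?_⟩
      simpa using memLp_inv_one_sub_coord v hp hp2 j
  refine (hLp.const_mul (2 ^ (∑ j, β j))).mono ?_ ?_
  · exact (contDiffOn_ratFun v α β (n := 0)).continuousOn.aestronglyMeasurable
      isOpen_interior.measurableSet
  · refine ae_restrict_of_forall_mem isOpen_interior.measurableSet fun x hx => ?_
    rw [Real.norm_eq_abs]
    exact (abs_ratFun_le v hk hx).trans (le_abs_self _)

theorem memLp_of_mem_ratSpan {k : ℤ} {p : ℝ≥0∞} (hp : 1 ≤ p) (h : 0 ≤ k ∨ p < 2 ∧ -1 ≤ k)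
    {f : EuclideanSpace ℝ (Fin 2) → ℝ} (hf : f ∈ ratSpan v k) :
    MemLp f p (volume.restrict (interior (triangle v))) := by
  induction hf using Submodule.span_induction with
  | mem f hf =>
    obtain ⟨α, β, hk, rfl⟩ := hf
    exact memLp_ratFun hp (h.imp hk.trans' fun h => ⟨h.1, h.2.trans hk⟩)
  | zero => exact MemLp.zero
  | add f g _ _ hf hg => exact hf.add hg
  | smul c f _ hf => exact hf.const_smul c

theorem memSobolev_ratFun {α β : Fin 3 → ℕ} {m : ℕ} {p : ℝ≥0∞} (hp : 1 ≤ p)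
    (h : (m : ℤ) ≤ regularityIndex α β ∨ p < 2 ∧ (m : ℤ) - 1 ≤ regularityIndex α β) :
    MemSobolev (interior (triangle v)) m p (ratFun v α β) := by
  refine ⟨memLp_ratFun hp (h.imp (by lia) fun h => ⟨h.1, by lia⟩), fun n hn I => ?_⟩
  have hmem : ratFun v α β ∈ ratSpan v (regularityIndex α β) :=
    Submodule.subset_span ⟨α, β, le_rfl, rfl⟩
  obtain ⟨g, hg, hint⟩ := exists_mem_ratSpan_weakDeriv
    (fun k => EuclideanSpace.single (I k) (1 : ℝ)) hmem
  refine ⟨g, memLp_of_mem_ratSpan hp (h.imp (by lia) fun h => ⟨h.1, by lia⟩) hg, ?_, ?_,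
    fun φ h1 h2 h3 => hint φ ⟨h1, h2, h3⟩⟩
  · exact (contDiffOn_of_mem_ratSpan hmem (n := 0)).continuousOn.locallyIntegrableOn
      isOpen_interior.measurableSet
  · exact (contDiffOn_of_mem_ratSpan hg (n := 0)).continuousOn.locallyIntegrableOn
      isOpen_interior.measurableSet

end Bounds

section LowerBound
open Filter Topology

/-- A function in `L^p` of a planar domain that is bounded below by `c * t ^ e` at scale `t` on a
cone with apex `a` satisfies `e * p > -2`. -/
theorem MeasureTheory.MemLp.neg_two_lt_of_le_on_cone {Ω : Set (EuclideanSpace ℝ (Fin 2))}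
    {h : EuclideanSpace ℝ (Fin 2) → ℝ} {p : ℝ≥0∞} (hp : p ≠ 0) (hptop : p ≠ ⊤)
    (hh : MemLp h p (volume.restrict Ω)) {c t₀ ε : ℝ} (hc : 0 < c)
    (ht₀ : 0 < t₀) (hε : 0 < ε) {e : ℤ} {a w₀ : EuclideanSpace ℝ (Fin 2)}
    (hcone : ∀ t, 0 < t → t < t₀ → ∀ w ∈ Metric.ball w₀ ε,
      a + t • w ∈ Ω ∧ c * t ^ e ≤ |h (a + t • w)|) : -2 < e * p.toReal := by
  by_contra! hle
  have hp0 : 0 < p.toReal := ENNReal.toReal_pos hp hptop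
  set S : ℝ → Set (EuclideanSpace ℝ (Fin 2)) := fun t => Metric.ball (a + t • w₀) (t * ε) with hS
  have hvol : ∀ t, 0 < t → volume (S t) = ENNReal.ofReal (t ^ 2) *
      volume (Metric.ball (0 : EuclideanSpace ℝ (Fin 2)) ε) := fun t ht => by
    rw [hS, Measure.addHaar_ball_mul_of_pos _ _ ht, finrank_euclideanSpace_fin]
  have hmem : ∀ t, 0 < t → ∀ y ∈ S t, ∃ w ∈ Metric.ball w₀ ε, y = a + t • w := by
    intro t ht y hy
    refine ⟨t⁻¹ • (y - a), ?_, by rw [smul_inv_smul₀ ht.ne']; abel⟩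
    rw [hS, mem_ball_iff_norm] at hy
    rw [mem_ball_iff_norm]
    have h1 : t⁻¹ • (y - a) - w₀ = t⁻¹ • (y - (a + t • w₀)) := by
      rw [← sub_sub, smul_sub _ (y - a), inv_smul_smul₀ ht.ne']
    rw [h1, norm_smul, norm_inv, Real.norm_of_nonneg ht.le, inv_mul_lt_iff₀ ht]
    exact hy
  set V := volume (Metric.ball (0 : EuclideanSpace ℝ (Fin 2)) ε) with hV
  have hVtop : V ≠ ⊤ := Metric.isBounded_ball.measure_lt_top.ne
  have hVpos : 0 < V := Metric.measure_ball_pos _ _ hε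
  have hlim : Tendsto (fun t => ∫⁻ x in S t, ‖h x‖ₑ ^ p.toReal ∂(volume.restrict Ω)) (𝓝[>] 0)
      (𝓝 0) := by
    refine tendsto_setLIntegral_zero ?_ ?_
    · exact (lintegral_rpow_enorm_lt_top_of_eLpNorm_lt_top hp hptop hh.2).ne
    · have h1 : Tendsto (fun t : ℝ => ENNReal.ofReal (t ^ 2) * V) (𝓝[>] 0) (𝓝 0) := by
        have h2 : Tendsto (fun t : ℝ => ENNReal.ofReal (t ^ 2)) (𝓝[>] 0) (𝓝 0) := by
          have : Continuous fun t : ℝ => ENNReal.ofReal (t ^ 2) :=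
            ENNReal.continuous_ofReal.comp (continuous_pow 2)
          simpa using (this.tendsto 0).mono_left nhdsWithin_le_nhds
        simpa using ENNReal.Tendsto.mul_const h2 (Or.inr hVtop)
      refine tendsto_of_tendsto_of_tendsto_of_le_of_le' tendsto_const_nhds h1
        (.of_forall fun _ => zero_le) ?_
      filter_upwards [self_mem_nhdsWithin] with t ht
      exact (Measure.restrict_apply_le _ _).trans (hvol t ht).le
  have hge : ∀ᶠ t in 𝓝[>] (0 : ℝ), ENNReal.ofReal (c ^ p.toReal) * V ≤
      ∫⁻ x in S t, ‖h x‖ₑ ^ p.toReal ∂(volume.restrict Ω) := by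
    have h0 : ∀ᶠ t in 𝓝[>] (0 : ℝ), t < min t₀ 1 :=
      nhdsWithin_le_nhds (eventually_lt_nhds (lt_min ht₀ one_pos))
    filter_upwards [self_mem_nhdsWithin, h0] with t ht htt
    have ht : 0 < t := ht
    have ht0 : t < t₀ := htt.trans_le (min_le_left _ _)
    have ht1 : t < 1 := htt.trans_le (min_le_right _ _)
    have hsub : S t ⊆ Ω := fun y hy => by
      obtain ⟨w, hw, rfl⟩ := hmem t ht y hy
      exact (hcone t ht ht0 w hw).1
    have hSm : MeasurableSet (S t) := measurableSet_ball
    have hscale : c ^ p.toReal ≤ (c * t ^ e) ^ p.toReal * t ^ 2 := by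
      rw [Real.mul_rpow hc.le (zpow_nonneg ht.le _), mul_assoc, ← Real.rpow_intCast,
        ← Real.rpow_mul ht.le, ← Real.rpow_natCast t 2, ← Real.rpow_add ht]
      refine le_mul_of_one_le_right (Real.rpow_nonneg hc.le _) ?_
      exact Real.one_le_rpow_of_pos_of_le_one_of_nonpos ht ht1.le (by push_cast; linarith)
    calc ENNReal.ofReal (c ^ p.toReal) * V
        ≤ ENNReal.ofReal ((c * t ^ e) ^ p.toReal * t ^ 2) * V := by gcongr
      _ = ENNReal.ofReal ((c * t ^ e) ^ p.toReal) * volume (S t) := by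
          rw [hvol t ht, ← mul_assoc, ENNReal.ofReal_mul (by positivity)]
      _ = ∫⁻ x in S t, ENNReal.ofReal ((c * t ^ e) ^ p.toReal) := by rw [setLIntegral_const]
      _ ≤ ∫⁻ x in S t, ‖h x‖ₑ ^ p.toReal := by
          refine setLIntegral_mono' hSm fun y hy => ?_
          obtain ⟨w, hw, rfl⟩ := hmem t ht y hy
          rw [← ENNReal.ofReal_rpow_of_nonneg (by positivity) hp0.le, Real.enorm_eq_ofReal_abs]
          gcongr
          exact (hcone t ht ht0 w hw).2
      _ = _ := by
          rw [Measure.restrict_restrict hSm, inter_eq_left.2 hsub]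
  have hfin := ge_of_tendsto hlim hge
  have hcp : 0 < ENNReal.ofReal (c ^ p.toReal) * V :=
    ENNReal.mul_pos (by simpa using Real.rpow_pos_of_pos hc _) hVpos.ne'
  exact absurd hfin (not_le.2 hcp)

end LowerBound

section PoleNumerator
open Polynomial

/-- The numerator of the `n`-th derivative of `z ^ a / (1 + z) ^ c` over `(1 + z) ^ (c + n)`. -/
noncomputable def poleNumerator (a c : ℕ) : ℕ → ℝ[X]
  | 0 => X ^ a
  | n + 1 => (X + 1) * derivative (poleNumerator a c n) - C ((c + n : ℕ) : ℝ) * poleNumerator a c n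

theorem hasDerivAt_poleNumerator_div (a c n : ℕ) {z : ℝ} (hz : 0 < z) :
    HasDerivAt (fun z => (poleNumerator a c n).eval z / (1 + z) ^ (c + n))
      ((poleNumerator a c (n + 1)).eval z / (1 + z) ^ (c + (n + 1))) z := by
  have h1 : 1 + z ≠ 0 := by positivity
  have h := ((poleNumerator a c n).hasDerivAt z).div (((hasDerivAt_id z).const_add 1).pow (c + n))
    (pow_ne_zero _ h1)
  convert! h using 1
  simp only [poleNumerator, id, Pi.pow_apply, ← add_assoc]
  rcases hN : c + n with _ | N
  · simp only [eval_sub, eval_mul, eval_add, eval_X, eval_one, eval_C]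
    field_simp
    simp [add_comm]
  · simp only [eval_sub, eval_mul, eval_add, eval_X, eval_one, eval_C, Nat.add_sub_cancel]
    field_simp
    push_cast
    ring

theorem poleNumerator_ne_zero {a c n : ℕ} (h : n = 0 ∨ 1 ≤ c) : poleNumerator a c n ≠ 0 := by
  rcases h with rfl | hc
  · exact pow_ne_zero _ X_ne_zero
  · have : (poleNumerator a c n).eval (-1) ≠ 0 := by
      induction n with
      | zero => simp [poleNumerator]
      | succ n ih =>
        have h2 : ((c + n : ℕ) : ℝ) ≠ 0 := by
          rw [Nat.cast_ne_zero]
          lia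
        simpa only [poleNumerator, eval_sub, eval_mul, eval_add, eval_X, eval_one, eval_C,
          neg_add_cancel, zero_mul, zero_sub, neg_ne_zero] using mul_ne_zero h2 ih
    rintro h
    simp [h] at this

theorem Polynomial.exists_pos_eval_ne_zero {q : ℝ[X]} (hq : q ≠ 0) : ∃ z, 0 < z ∧ q.eval z ≠ 0 := by
  by_contra! h
  exact hq (q.eq_zero_of_infinite_isRoot ((Set.Ioi_infinite 0).mono fun z hz => h z hz))

end PoleNumerator

section Scaling
open Filter Topology

theorem hasLineDerivAt_dirDeriv {E : Type*} [NormedAddCommGroup E] [NormedSpace ℝ E] {Ω : Set E}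
    (hΩ : IsOpen Ω) {f : E → ℝ} (hf : ContDiffOn ℝ ((⊤ : ℕ∞) : WithTop ℕ∞) f Ω) (a : E) (n : ℕ)
    {x : E} (hx : x ∈ Ω) (b : E) :
    HasLineDerivAt ℝ ((dirDeriv a)^[n] f) (dirDeriv b ((dirDeriv a)^[n] f) x) x b :=
  (((hf.iterate_dirDeriv hΩ a n).contDiffAt (hΩ.mem_nhds hx)).differentiableAt
    (by simp)).hasFDerivAt.hasLineDerivAt b

variable (v : AffineBasis (Fin 3) ℝ (EuclideanSpace ℝ (Fin 2)))

/-- The function `λ^α / (1 - λ)^β` at `v j + t • w`, divided by its leading power of `t`. -/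
noncomputable def rescaledRatFun (α β : Fin 3 → ℕ) (j k l : Fin 3)
    (q : ℝ × EuclideanSpace ℝ (Fin 2)) : ℝ :=
  (1 + q.1 * coordLinear v j q.2) ^ α j / (-coordLinear v j q.2) ^ β j *
    (coordLinear v k q.2 ^ α k / (1 - q.1 * coordLinear v k q.2) ^ β k) *
    (coordLinear v l q.2 ^ α l / (1 - q.1 * coordLinear v l q.2) ^ β l)

/-- An open set on which the denominators of `rescaledRatFun` are positive. -/
def rescaledDomain (j k l : Fin 3) : Set (ℝ × EuclideanSpace ℝ (Fin 2)) :=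
  {q | 0 < -coordLinear v j q.2 ∧ 0 < 1 - q.1 * coordLinear v k q.2 ∧
    0 < 1 - q.1 * coordLinear v l q.2}

theorem isOpen_rescaledDomain (j k l : Fin 3) : IsOpen (rescaledDomain v j k l) := by
  simp only [rescaledDomain, ofPred_and]
  refine (isOpen_lt ?_ ?_).inter ((isOpen_lt ?_ ?_).inter (isOpen_lt ?_ ?_)) <;> fun_prop

theorem contDiffOn_rescaledRatFun (α β : Fin 3 → ℕ) (j k l : Fin 3) {n : WithTop ℕ∞} :
    ContDiffOn ℝ n (rescaledRatFun v α β j k l) (rescaledDomain v j k l) := by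
  have hℓ : ∀ i, ContDiff ℝ n fun q : ℝ × EuclideanSpace ℝ (Fin 2) => coordLinear v i q.2 :=
    fun i => (coordLinear v i).contDiff.comp contDiff_snd
  refine ((ContDiffOn.div ?_ ?_ ?_).mul (ContDiffOn.div ?_ ?_ ?_)).mul (ContDiffOn.div ?_ ?_ ?_)
  · exact ((contDiff_const.add (contDiff_fst.mul (hℓ j))).pow _).contDiffOn
  · exact ((hℓ j).neg.pow _).contDiffOn
  · exact fun q hq => pow_ne_zero _ hq.1.ne'
  · exact ((hℓ k).pow _).contDiffOn
  · exact ((contDiff_const.sub (contDiff_fst.mul (hℓ k))).pow _).contDiffOn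
  · exact fun q hq => pow_ne_zero _ hq.2.1.ne'
  · exact ((hℓ l).pow _).contDiffOn
  · exact ((contDiff_const.sub (contDiff_fst.mul (hℓ l))).pow _).contDiffOn
  · exact fun q hq => pow_ne_zero _ hq.2.2.ne'

theorem Fin.eq_or_eq_or_eq_of_ne {j k l : Fin 3} (hk : k ≠ j) (hl : l ≠ j) (hkl : k ≠ l)
    (i : Fin 3) : i = j ∨ i = k ∨ i = l := by decide +revert

@[to_additive]
theorem Fin.prod_three_of_ne {M : Type*} [CommMonoid M] {j k l : Fin 3} (hk : k ≠ j) (hl : l ≠ j)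
    (hkl : k ≠ l) (f : Fin 3 → M) : ∏ i, f i = f j * f k * f l := by
  have h : (Finset.univ : Finset (Fin 3)) = {j, k, l} := by decide +revert
  rw [h, Finset.prod_insert (by simp [hk.symm, hl.symm]), Finset.prod_pair hkl, mul_assoc]

theorem coord_vertex_add (i j : Fin 3) (t : ℝ) (w : EuclideanSpace ℝ (Fin 2)) :
    v.coord i (v j + t • w) = (if i = j then 1 else 0) + t * coordLinear v i w := by
  rw [coord_add, v.coord_apply, map_smul, smul_eq_mul]

variable {v} {j k l : Fin 3}

theorem ratFun_vertex_add (hk : k ≠ j) (hl : l ≠ j) (hkl : k ≠ l) (α β : Fin 3 → ℕ) {t : ℝ}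
    (ht : t ≠ 0) (w : EuclideanSpace ℝ (Fin 2)) :
    ratFun v α β (v j + t • w) =
      t ^ (α k + α l - β j : ℤ) * rescaledRatFun v α β j k l (t, w) := by
  rw [ratFun_eq_prod, Fin.prod_three_of_ne hk hl hkl, zpow_sub₀ ht, zpow_add₀ ht]
  simp only [coord_vertex_add, if_true, if_neg hk, if_neg hl, zero_add, rescaledRatFun,
    zpow_natCast]
  have h : 1 - (1 + t * coordLinear v j w) = t * -coordLinear v j w := by ring
  rw [h]
  simp only [div_eq_mul_inv, mul_inv, mul_pow]
  ring

theorem mem_rescaledDomain_of_mem (hk : k ≠ j) (hl : l ≠ j) {t : ℝ} (ht : 0 < t)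
    {w : EuclideanSpace ℝ (Fin 2)} (h : v j + t • w ∈ interior (triangle v)) :
    (t, w) ∈ rescaledDomain v j k l := by
  have hlt := coord_lt_one v h
  simp only [coord_vertex_add] at hlt
  have h1 := hlt j
  have h2 := hlt k
  have h3 := hlt l
  simp only [if_true, if_neg hk, if_neg hl] at h1 h2 h3
  exact ⟨pos_of_mul_pos_right (by linarith : 0 < t * -coordLinear v j w) ht.le, by linarith,
    by linarith⟩

theorem iterate_dirDeriv_vertex_add (hk : k ≠ j) (hl : l ≠ j) (hkl : k ≠ l) (α β : Fin 3 → ℕ)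
    (u : EuclideanSpace ℝ (Fin 2)) (n : ℕ) {t : ℝ} (ht : 0 < t) {w : EuclideanSpace ℝ (Fin 2)}
    (h : v j + t • w ∈ interior (triangle v)) :
    (dirDeriv u)^[n] (ratFun v α β) (v j + t • w) =
      t ^ (α k + α l - β j - n : ℤ) *
        (dirDeriv ((0 : ℝ), u))^[n] (rescaledRatFun v α β j k l) (t, w) := by
  induction n generalizing w with
  | zero => simpa using ratFun_vertex_add hk hl hkl α β ht.ne' w
  | succ n ih =>
    have hA := hasLineDerivAt_dirDeriv isOpen_interior (contDiffOn_ratFun v α β) u n h (t • u)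
    have hB := hasLineDerivAt_dirDeriv (isOpen_rescaledDomain v j k l)
      (contDiffOn_rescaledRatFun v α β j k l) ((0 : ℝ), u) n (mem_rescaledDomain_of_mem hk hl ht h)
      ((0 : ℝ), u)
    have hB := HasDerivAt.const_mul (t ^ (α k + α l - β j - n : ℤ)) hB
    have hcont : Continuous fun s : ℝ => v j + t • w + s • t • u := by fun_prop
    have hev : ∀ᶠ s : ℝ in 𝓝 0, v j + t • w + s • t • u ∈ interior (triangle v) :=
      hcont.continuousAt.eventually_mem (by simpa using isOpen_interior.mem_nhds h)
    have hA' := HasDerivAt.congr_of_eventuallyEq hB (f₁ := fun s =>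
        (dirDeriv u)^[n] (ratFun v α β) (v j + t • w + s • t • u)) (by
      filter_upwards [hev] with s hs
      have e : v j + t • w + s • t • u = v j + t • (w + s • u) := by
        rw [smul_add, smul_comm s t, add_assoc]
      rw [e] at hs ⊢
      rw [ih hs]
      simp)
    have heq := hA.unique hA'
    rw [Function.iterate_succ_apply', Function.iterate_succ_apply']
    have hsmul : dirDeriv (t • u) ((dirDeriv u)^[n] (ratFun v α β)) (v j + t • w) =
        t * dirDeriv u ((dirDeriv u)^[n] (ratFun v α β)) (v j + t • w) := by
      simp [dirDeriv]
    rw [hsmul] at heq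
    have hz : t ^ (α k + α l - β j - n : ℤ) =
        t * t ^ (α k + α l - β j - (n + 1 : ℕ) : ℤ) := by
      rw [← zpow_one_add₀ ht.ne']
      congr 1
      push_cast
      ring
    rw [hz, mul_assoc] at heq
    exact mul_left_cancel₀ ht.ne' heq

theorem coordLinear_vertex_sub (i a b : Fin 3) :
    coordLinear v i (v a - v b) = (if i = a then 1 else 0) - (if i = b then 1 else 0) := by
  rw [coordLinear_sub, v.coord_apply, v.coord_apply]

theorem mem_rescaledDomain_zero {z : ℝ} (hz : 0 < z) (hk : k ≠ j) (hl : l ≠ j) :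
    ((0 : ℝ), v l - v j + z • (v k - v j)) ∈ rescaledDomain v j k l := by
  simp only [rescaledDomain, mem_ofPred_eq, map_add, map_smul, coordLinear_vertex_sub, hk.symm,
    hl.symm, if_true, if_false, zero_mul, sub_zero, smul_eq_mul]
  refine ⟨by linarith, one_pos, one_pos⟩

theorem iterate_dirDeriv_rescaledRatFun_zero (hk : k ≠ j) (hl : l ≠ j) (hkl : k ≠ l)
    (α β : Fin 3 → ℕ) (n : ℕ) {z : ℝ} (hz : 0 < z) :
    (dirDeriv ((0 : ℝ), v k - v j))^[n] (rescaledRatFun v α β j k l)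
      ((0 : ℝ), v l - v j + z • (v k - v j)) =
      (poleNumerator (α k) (β j) n).eval z / (1 + z) ^ (β j + n) := by
  induction n generalizing z with
  | zero =>
    have h : 0 - 1 + z * (0 - 1) = -(1 + z) := by ring
    simp only [Function.iterate_zero, id, rescaledRatFun, poleNumerator, map_add, map_smul,
      coordLinear_vertex_sub, hk, hl, hk.symm, hl.symm, hkl, hkl.symm, if_true, if_false,
      smul_eq_mul, h]
    simp
    ring
  | succ n ih =>
    have hB := hasLineDerivAt_dirDeriv (isOpen_rescaledDomain v j k l)
      (contDiffOn_rescaledRatFun v α β j k l) ((0 : ℝ), v k - v j) n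
      (mem_rescaledDomain_zero hz hk hl) ((0 : ℝ), v k - v j)
    have hC : HasDerivAt (fun s => (poleNumerator (α k) (β j) n).eval (z + s) /
        (1 + (z + s)) ^ (β j + n)) _ 0 := HasDerivAt.comp_const_add z 0
      (by simpa using hasDerivAt_poleNumerator_div (α k) (β j) n hz)
    have hcont : Continuous fun s : ℝ => z + s := by fun_prop
    have hev : ∀ᶠ s : ℝ in 𝓝 0, 0 < z + s :=
      hcont.continuousAt.eventually (eventually_gt_nhds (by simpa using hz))
    have hC' := HasDerivAt.congr_of_eventuallyEq hC (f₁ := fun s : ℝ =>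
        (dirDeriv ((0 : ℝ), v k - v j))^[n] (rescaledRatFun v α β j k l)
          (((0 : ℝ), v l - v j + z • (v k - v j)) + s • ((0 : ℝ), v k - v j))) (by
      filter_upwards [hev] with s hs
      rw [← ih hs]
      simp [add_smul, add_assoc])
    rw [Function.iterate_succ_apply']
    exact hB.unique hC'

/-- The `m`-th derivative in direction `v k - v j` blows up at the vertex `v j` at the rate given by
its degree of homogeneity, on a cone. -/
theorem exists_cone_le_abs_iterate_dirDeriv (hk : k ≠ j) (hl : l ≠ j) (hkl : k ≠ l)
    (α β : Fin 3 → ℕ) {m : ℕ} (hm : m = 0 ∨ 1 ≤ β j) :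
    ∃ c > 0, ∃ t₀ > 0, ∃ ε > 0, ∃ w₀ : EuclideanSpace ℝ (Fin 2), ∀ t, 0 < t → t < t₀ →
      ∀ w ∈ Metric.ball w₀ ε, v j + t • w ∈ interior (triangle v) ∧
        c * t ^ (α k + α l - β j - m : ℤ) ≤
          |(dirDeriv (v k - v j))^[m] (ratFun v α β) (v j + t • w)| := by
  obtain ⟨z, hz, hq⟩ := Polynomial.exists_pos_eval_ne_zero
    (poleNumerator_ne_zero (a := α k) hm)
  set w₀ := v l - v j + z • (v k - v j) with hw₀
  set H := (dirDeriv ((0 : ℝ), v k - v j))^[m] (rescaledRatFun v α β j k l) with hH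
  have hH0 : H (0, w₀) ≠ 0 := by
    rw [hH, hw₀, iterate_dirDeriv_rescaledRatFun_zero hk hl hkl α β m hz]
    positivity
  have hHc : ContinuousAt H (0, w₀) :=
    ((contDiffOn_rescaledRatFun v α β j k l).iterate_dirDeriv (isOpen_rescaledDomain v j k l)
      _ m).continuousOn.continuousAt
      ((isOpen_rescaledDomain v j k l).mem_nhds (mem_rescaledDomain_zero hz hk hl))
  have e1 : ∀ᶠ q in 𝓝 ((0 : ℝ), w₀), |H (0, w₀)| / 2 < |H q| :=
    hHc.abs.eventually (eventually_gt_nhds (half_lt_self (abs_pos.2 hH0)))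
  have hpos : ∀ f : ℝ × EuclideanSpace ℝ (Fin 2) → ℝ, Continuous f → 0 < f (0, w₀) →
      ∀ᶠ q in 𝓝 ((0 : ℝ), w₀), 0 < f q :=
    fun f hf h => hf.continuousAt.eventually (eventually_gt_nhds h)
  have e2 := hpos (fun q => 1 + q.1 * coordLinear v j q.2) (by fun_prop) (by simp)
  have e3 := hpos (fun q => coordLinear v k q.2) (by fun_prop) (by
    simpa [hw₀, coordLinear_vertex_sub, hk, hkl] using hz)
  have e4 := hpos (fun q => coordLinear v l q.2) (by fun_prop) (by
    simp [hw₀, coordLinear_vertex_sub, hl, hkl.symm])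
  obtain ⟨δ, hδ, hball⟩ := Metric.eventually_nhds_iff_ball.1 (e1.and (e2.and (e3.and e4)))
  refine ⟨|H (0, w₀)| / 2, half_pos (abs_pos.2 hH0), δ, hδ, δ, hδ, w₀, fun t ht htδ w hw => ?_⟩
  obtain ⟨h1, h2, h3, h4⟩ := hball (t, w) (by
    rw [← ball_prod_same]
    exact ⟨by simpa [abs_of_pos ht] using htδ, hw⟩)
  have hmem : v j + t • w ∈ interior (triangle v) := by
    rw [mem_interior_triangle]
    intro i
    rw [coord_vertex_add]
    rcases Fin.eq_or_eq_or_eq_of_ne hk hl hkl i with rfl | rfl | rfl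
    · simpa using h2
    · simpa [hk] using mul_pos ht h3
    · simpa [hl] using mul_pos ht h4
  refine ⟨hmem, ?_⟩
  rw [iterate_dirDeriv_vertex_add hk hl hkl α β _ m ht hmem, abs_mul,
    abs_of_pos (zpow_pos ht _), mul_comm]
  exact mul_le_mul_of_nonneg_left h1.le (zpow_pos ht _).le

end Scaling

theorem MemSobolev.lt_regularityIndex {v : AffineBasis (Fin 3) ℝ (EuclideanSpace ℝ (Fin 2))}
    {α β : Fin 3 → ℕ} {m : ℕ} (hαβ : m = 0 ∨ ∃ j, α j + β j = multiIndexSup (α + β) ∧ 1 ≤ β j)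
    {p : ℝ≥0∞} (hp : p ≠ 0) (hptop : p ≠ ⊤)
    (h : MemSobolev (interior (triangle v)) m p (ratFun v α β)) :
    (m : ℝ) - 2 / p.toReal < regularityIndex α β := by
  obtain ⟨j, hj, hm⟩ : ∃ j, α j + β j = multiIndexSup (α + β) ∧ (m = 0 ∨ 1 ≤ β j) := by
    rcases hαβ with hm | ⟨j, hj, hβ⟩
    · obtain ⟨j, -, hj⟩ := Finset.exists_mem_eq_sup Finset.univ Finset.univ_nonempty (α + β)
      exact ⟨j, hj.symm, Or.inl hm⟩
    · exact ⟨j, hj, Or.inr hβ⟩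
  obtain ⟨k, l, hk, hl, hkl⟩ : ∃ k l, k ≠ j ∧ l ≠ j ∧ k ≠ l := by clear hj hm; decide +revert
  obtain ⟨c, hc, t₀, ht₀, ε, hε, w₀, hcone⟩ :=
    exists_cone_le_abs_iterate_dirDeriv (v := v) hk hl hkl α β hm
  have hlt := (h.memLp_iterate_dirDeriv isOpen_interior (contDiffOn_ratFun v α β)
    (v k - v j)).neg_two_lt_of_le_on_cone hp hptop hc ht₀ hε hcone
  have hidx : regularityIndex α β = α k + α l - β j := by
    have hsum : ∑ i, (α i : ℤ) = α j + α k + α l := Fin.sum_three_of_ne hk hl hkl _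
    rw [regularityIndex, ← hj]
    push_cast
    rw [hsum]
    ring
  have hp0 : 0 < p.toReal := ENNReal.toReal_pos hp hptop
  rw [← hidx] at hlt
  push_cast at hlt
  rw [sub_lt_comm, lt_div_iff₀ hp0]
  linarith

theorem MemSobolev.mono_exponent {d m : ℕ} {Ω : Set (EuclideanSpace ℝ (Fin d))}
    [IsFiniteMeasure (volume.restrict Ω)] {p q : ℝ≥0∞} {u : EuclideanSpace ℝ (Fin d) → ℝ}
    (h : MemSobolev Ω m q u) (hpq : p ≤ q) : MemSobolev Ω m p u :=
  ⟨h.1.mono_exponent hpq, fun n hn I =>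
    let ⟨g, hg, hw⟩ := h.2 n hn I
    ⟨g, hg.mono_exponent hpq, hw⟩⟩

theorem sub_two_div_lt_iff_of_lt_two {m : ℕ} {k : ℤ} {p : ℝ≥0∞} (hp : 1 ≤ p) (hp2 : p < 2) :
    (m : ℝ) - 2 / p.toReal < k ↔ (m : ℤ) - 1 ≤ k := by
  have hptop : p ≠ ⊤ := (hp2.trans_le le_top).ne
  have h1 : 1 ≤ p.toReal := by simpa using (ENNReal.toReal_le_toReal (by simp) hptop).2 hp
  have h2 : p.toReal < 2 := by simpa using (ENNReal.toReal_lt_toReal hptop (by simp)).2 hp2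
  have h3 : 2 / p.toReal ≤ 2 := by rw [div_le_iff₀ (by positivity)]; linarith
  have h4 : 1 < 2 / p.toReal := by rw [lt_div_iff₀ (by positivity)]; linarith
  constructor
  · intro h
    have : ((m - 2 : ℤ) : ℝ) < k := by push_cast; linarith
    have := Int.cast_lt.1 this
    lia
  · intro h
    have : ((m - 1 : ℤ) : ℝ) ≤ k := Int.cast_le.2 h
    push_cast at this
    linarith

theorem sub_two_div_lt_iff_of_two_le {m : ℕ} {k : ℤ} {p : ℝ≥0∞} (hp2 : 2 ≤ p) (hptop : p ≠ ⊤) :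
    (m : ℝ) - 2 / p.toReal < k ↔ (m : ℤ) ≤ k := by
  have h2 : 2 ≤ p.toReal := by simpa using (ENNReal.toReal_le_toReal (by simp) hptop).2 hp2
  have h3 : 2 / p.toReal ≤ 1 := by rw [div_le_iff₀ (by positivity)]; linarith
  have h4 : 0 < 2 / p.toReal := by positivity
  constructor
  · intro h
    have : ((m - 1 : ℤ) : ℝ) < k := by push_cast; linarith
    have := Int.cast_lt.1 this
    lia
  · intro h
    have : ((m : ℤ) : ℝ) ≤ k := Int.cast_le.2 h
    push_cast at this
    linarith

section Criterion

variable {v : AffineBasis (Fin 3) ℝ (EuclideanSpace ℝ (Fin 2))} {α β : Fin 3 → ℕ} {m : ℕ}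
  {p : ℝ≥0∞}

theorem memSobolev_ratFun_of_lt (hp : 1 ≤ p) (hptop : p ≠ ⊤)
    (h : (m : ℝ) - 2 / p.toReal < regularityIndex α β) :
    MemSobolev (interior (triangle v)) m p (ratFun v α β) := by
  rcases lt_or_ge p 2 with hp2 | hp2
  · exact memSobolev_ratFun hp (Or.inr ⟨hp2, (sub_two_div_lt_iff_of_lt_two hp hp2).1 h⟩)
  · exact memSobolev_ratFun hp (Or.inl ((sub_two_div_lt_iff_of_two_le hp2 hptop).1 h))

theorem memSobolev_ratFun_iff_lt
    (hαβ : m = 0 ∨ ∃ j, α j + β j = multiIndexSup (α + β) ∧ 1 ≤ β j) (hp : 1 ≤ p) (hptop : p ≠ ⊤) :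
    MemSobolev (interior (triangle v)) m p (ratFun v α β) ↔
      (m : ℝ) - 2 / p.toReal < regularityIndex α β :=
  ⟨fun h => h.lt_regularityIndex hαβ (zero_lt_one.trans_le hp).ne' hptop,
    memSobolev_ratFun_of_lt hp hptop⟩

theorem memSobolev_ratFun_iff_le
    (hαβ : m = 0 ∨ ∃ j, α j + β j = multiIndexSup (α + β) ∧ 1 ≤ β j) (hp2 : 2 ≤ p) :
    MemSobolev (interior (triangle v)) m p (ratFun v α β) ↔ (m : ℤ) ≤ regularityIndex α β := by
  have hp : (1 : ℝ≥0∞) ≤ 2 := one_le_two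
  have : IsFiniteMeasure (volume.restrict (interior (triangle v))) :=
    ⟨by simpa using (isBounded_interior_triangle v).measure_lt_top⟩
  refine ⟨fun h => ?_, fun h => memSobolev_ratFun (hp.trans hp2) (Or.inl h)⟩
  exact (sub_two_div_lt_iff_of_two_le le_rfl (by simp)).1
    ((memSobolev_ratFun_iff_lt hαβ hp (by simp)).1 (h.mono_exponent hp2))

end Criterion

theorem mainTheorem5
    (v : AffineBasis (Fin 3) ℝ (EuclideanSpace ℝ (Fin 2))) (m : ℕ) (α β : Fin 3 → ℕ) :
    -- the criterion, as an equivalence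
    ((m = 0 ∨ ∃ j, α j + β j = multiIndexSup (α + β) ∧ 1 ≤ β j) →
      (∀ p : ℝ≥0∞, 1 ≤ p → p ≠ ⊤ →
        (MemSobolev (interior (triangle v)) m p (ratFun v α β) ↔
          (regularityIndex α β : ℝ) > (m : ℝ) - 2 / p.toReal)) ∧
      (MemSobolev (interior (triangle v)) m ⊤ (ratFun v α β) ↔
        regularityIndex α β ≥ (m : ℤ)) ∧
      (∀ p : ℝ≥0∞, 1 ≤ p → p < 2 →
        (MemSobolev (interior (triangle v)) m p (ratFun v α β) ↔
          (m : ℤ) - 1 ≤ regularityIndex α β)) ∧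
      (∀ p : ℝ≥0∞, 2 ≤ p →
        (MemSobolev (interior (triangle v)) m p (ratFun v α β) ↔
          (m : ℤ) ≤ regularityIndex α β))) ∧
    -- sufficiency of the criterion, for all multi-indices
    (∀ p : ℝ≥0∞, 1 ≤ p → p ≠ ⊤ →
      (regularityIndex α β : ℝ) > (m : ℝ) - 2 / p.toReal →
        MemSobolev (interior (triangle v)) m p (ratFun v α β)) ∧
    (regularityIndex α β ≥ (m : ℤ) →
      MemSobolev (interior (triangle v)) m ⊤ (ratFun v α β)) ∧
    (∀ p : ℝ≥0∞, 1 ≤ p → p < 2 → (m : ℤ) - 1 ≤ regularityIndex α β →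
      MemSobolev (interior (triangle v)) m p (ratFun v α β)) ∧
    (∀ p : ℝ≥0∞, 2 ≤ p → (m : ℤ) ≤ regularityIndex α β →
      MemSobolev (interior (triangle v)) m p (ratFun v α β)) := by
  refine ⟨fun hαβ => ⟨fun p hp hptop => memSobolev_ratFun_iff_lt hαβ hp hptop,
    memSobolev_ratFun_iff_le hαβ le_top, fun p hp hp2 => ?_,
    fun p hp2 => memSobolev_ratFun_iff_le hαβ hp2⟩,
    fun p hp hptop => memSobolev_ratFun_of_lt hp hptop,
    fun h => memSobolev_ratFun le_top (Or.inl h),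
    fun p hp hp2 h => memSobolev_ratFun hp (Or.inr ⟨hp2, h⟩),
    fun p hp2 h => memSobolev_ratFun (one_le_two.trans hp2) (Or.inl h)⟩
  rw [memSobolev_ratFun_iff_lt hαβ hp (hp2.trans_le le_top).ne,
    sub_two_div_lt_iff_of_lt_two hp hp2]
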